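/- Let $\mathcal P$ be a set and let $\mathcal V$, $\mathcal H$ be groupoids (small categories in which all arrows are invertible) with set of objects $\mathcal P$; products are written in diagrammatic order. Let $t,b$ be the source and end maps of $\mathcal V$ and $l,r$ those of $\mathcal H$. Let $(\mathcal V,\mathcal H)$ be a matched pair of groupoids: there are given, for all $x\in\mathcal H$ and $g\in\mathcal V$ with $r(x)=t(g)$, elements $x\triangleright g\in\mathcal V$ and $x\triangleleft g\in\mathcal H$, where $\triangleright$ is a left action of $\mathcal H$ on $t:\mathcal V\to\mathcal P$ and $\triangleleft$ is a right action of $\mathcal V$ on $r:\mathcal H\to\mathcal P$, such that $$b(x\triangleright g)=l(x\triangleleft g),\qquad x\triangleright fg=(x\triangleright f)\bigl((x\triangleleft f)\triangleright g\bigr),\qquad xy\triangleleft g=\bigl(x\triangleleft(y\triangleright g)\bigr)(y\triangleleft g)$$ whenever these are defined. A representation of $(\mathcal V,\mathcal H)$ is a set $E$ with a map $|\cdot|:E\to\mathcal V$ (the grading) and a left action $\triangleright$ of $\mathcal H$ on the map $p:E\to\mathcal P$, $p(e)=t(|e|)$, such that $|x\triangleright e|=x\triangleright|e|$; put $q(e)=b(|e|)$.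 Morphisms are the maps that preserve the gradings and the actions. The category $\operatorname{Rep}(\mathcal V,\mathcal H)$ of representations is monoidal with $E\otimes F=\{(e,f)\in E\times F: q(e)=p(f)\}$, $|(e,f)|=|e||f|$, $x\triangleright(e,f)=\bigl(x\triangleright e,(x\triangleleft|e|)\triangleright f\bigr)$; the unit object is $\mathcal P$ with $|a|=\mathrm{id}_{\mathcal V}\,a$ and $x\triangleright r(x)=l(x)$. A rotation for $(\mathcal V,\mathcal H)$ is a morphism of groupoids $\kappa:\mathcal V\to\mathcal H$ which is the identity on $\mathcal P$ and satisfies $y\,\kappa(g)=\kappa(y\triangleright g)(y\triangleleft g)$ for all $y\in\mathcal H$, $g\in\mathcal V$ with $r(y)=t(g)$. A matched pair of rotations is a pair $(\xi,\eta)$ of rotations such that, for all $f,g\in\mathcal V$ with $b(g)=t(f)$, $$b\bigl(\eta(g)\triangleright f\bigr)=b\bigl(\xi(f)^{-1}\triangleright g^{-1}\bigr)\quad\text{and}\quad\bigl(\eta(g)\triangleright f\bigr)\bigl(\xi(f)^{-1}\triangleright g^{-1}\bigr)^{-1}=gf .$$ Theorem. There is a bijective correspondence between matched pairs of rotations for $(\mathcal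 V,\mathcal H)$ and braidings on the monoidal category $\operatorname{Rep}(\mathcal V,\mathcal H)$. For a matched pair of rotations $(\xi,\eta)$ and representations $D$, $E$, the corresponding braiding $c_{E,D}:E\otimes D\to D\otimes E$ is given by $$c_{E,D}(e,d)=\Bigl(\eta(|e|)\triangleright d,\ \bigl(\xi(|d|)^{-1}\triangleleft|e|^{-1}\bigr)\triangleright e\Bigr).$$ -/

import Mathlib

open CategoryTheory MonoidalCategory

universe u

section

variable {P : Type u}

/-- The set of all arrows of a groupoid `G` with base `P`. -/
@[ext] structure Arr (G : Groupoid.{u} P) where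
  /-- the source of the arrow -/
  src : P
  /-- the end of the arrow -/
  tgt : P
  /-- the arrow itself -/
  hom : src ⟶ tgt

namespace Arr

variable {G : Groupoid.{u} P}

/-- The product `f g` (first `f`, then `g`) of two composable arrows. -/
@[reducible] def comp (f g : Arr G) (h : f.tgt = g.src) : Arr G where
  src := f.src
  tgt := g.tgt
  hom := f.hom ≫ eqToHom h ≫ g.hom

/-- The identity arrow at a point of the base. -/
@[reducible] def id (G : Groupoid.{u} P) (p : P) : Arr G where
  src := p
  tgt := p
  hom := 𝟙 p

/-- The inverse arrow. -/
@[reducible] def inv (f : Arr G) : Arr G where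
  src := f.tgt
  tgt := f.src
  hom := Groupoid.inv f.hom

theorem comp_assoc (f g k : Arr G) (h : f.tgt = g.src) (h' : g.tgt = k.src) :
    (f.comp g h).comp k h' = f.comp (g.comp k h') h := by
  simp [comp]

theorem id_comp (f : Arr G) (p : P) (h : p = f.src) : (id G p).comp f h = f := by
  subst h; simp [comp, id]

theorem comp_id (f : Arr G) (p : P) (h : f.tgt = p) : f.comp (id G p) h = f := by
  subst h; simp [comp, id]

theorem inv_comp (f : Arr G) : f.inv.comp f rfl = id G f.tgt := by
  simp [comp, id, inv]

theorem comp_inv (f : Arr G) : f.comp f.inv rfl = id G f.src := by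
  simp [comp, id, inv]

theorem eq_id_of_comp_self (f : Arr G) (h : f.tgt = f.src) (hf : f.comp f h = f) :
    f = id G f.src := by
  obtain ⟨s, t, f⟩ := f
  obtain rfl : t = s := h
  have h2 : f ≫ f = f := by simpa [comp] using hf
  have h3 : f = 𝟙 t := by simpa using congrArg (fun k => Groupoid.inv f ≫ k) h2
  subst h3; rfl

end Arr

/-- The structure of a matched pair of groupoids on two groupoids `V` (vertical) and `H`
(horizontal) with the same base `P`: a left action `lact x g = x ▷ g` of `H` on the source map
of `V` and a right action `ract x g = x ◁ g` of `V` on the end map of `H`, which are compatible. -/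
structure MatchedPair (V H : Groupoid.{u} P) where
  /-- `x ▷ g` -/
  lact (x : Arr H) (g : Arr V) (h : x.tgt = g.src) : Arr V
  /-- `x ◁ g` -/
  ract (x : Arr H) (g : Arr V) (h : x.tgt = g.src) : Arr H
  src_lact (x : Arr H) (g : Arr V) (h : x.tgt = g.src) : (lact x g h).src = x.src
  lact_lact (x y : Arr H) (g : Arr V) (hxy : x.tgt = y.src) (h : y.tgt = g.src) :
    lact x (lact y g h) (hxy.trans (src_lact y g h).symm) = lact (x.comp y hxy) g h
  id_lact (g : Arr V) : lact (Arr.id H g.src) g rfl = g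
  tgt_ract (x : Arr H) (g : Arr V) (h : x.tgt = g.src) : (ract x g h).tgt = g.tgt
  ract_ract (x : Arr H) (f g : Arr V) (h : x.tgt = f.src) (hfg : f.tgt = g.src) :
    ract (ract x f h) g ((tgt_ract x f h).trans hfg) = ract x (f.comp g hfg) h
  ract_id (x : Arr H) : ract x (Arr.id V x.tgt) rfl = x
  tgt_lact (x : Arr H) (g : Arr V) (h : x.tgt = g.src) : (lact x g h).tgt = (ract x g h).src
  /-- `x ▷ fg = (x ▷ f) ((x ◁ f) ▷ g)` -/
  lact_comp (x : Arr H) (f g : Arr V) (h : x.tgt = f.src) (hfg : f.tgt = g.src) :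
    lact x (f.comp g hfg) h =
      (lact x f h).comp (lact (ract x f h) g ((tgt_ract x f h).trans hfg))
        ((tgt_lact x f h).trans (src_lact (ract x f h) g _).symm)
  /-- `xy ◁ g = (x ◁ (y ▷ g)) (y ◁ g)` -/
  comp_ract (x y : Arr H) (g : Arr V) (hxy : x.tgt = y.src) (h : y.tgt = g.src) :
    ract (x.comp y hxy) g h =
      (ract x (lact y g h) (hxy.trans (src_lact y g h).symm)).comp (ract y g h)
        ((tgt_ract x (lact y g h) _).trans (tgt_lact y g h))

namespace MatchedPair

variable {V H : Groupoid.{u} P}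

theorem ract_id' (M : MatchedPair V H) (x : Arr H) (p : P) (h : x.tgt = p) :
    M.ract x (Arr.id V p) h = x := by
  subst h; exact M.ract_id x

theorem lact_id (M : MatchedPair V H) (x : Arr H) (p : P) (h : x.tgt = p) :
    M.lact x (Arr.id V p) h = Arr.id V x.src := by
  have h1 := M.lact_comp x (Arr.id V p) (Arr.id V p) h rfl
  simp only [Arr.comp_id, M.ract_id'] at h1
  have h2 := Arr.eq_id_of_comp_self _ _ h1.symm
  rw [M.src_lact] at h2
  exact h2

theorem id_ract (M : MatchedPair V H) (g : Arr V) :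
    M.ract (Arr.id H g.src) g rfl = Arr.id H g.tgt := by
  have h1 := M.comp_ract (Arr.id H g.src) (Arr.id H g.src) g rfl rfl
  simp only [Arr.comp_id, M.id_lact] at h1
  have h2 := Arr.eq_id_of_comp_self _ _ h1.symm
  have h3 := M.tgt_lact (Arr.id H g.src) g rfl
  rw [M.id_lact] at h3
  rw [h2, ← h3]

/-- A (set-theoretic) representation of a matched pair `(V, H)`: a set graded over `V` (the degree
of `e` is `deg e`) with a left action of `H` on the map `p`, `p e` being the source of `deg e`,
such that `deg (x ▷ e) = x ▷ deg e`. The second structure map `q e` is the end of `deg e`. -/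
structure Representation (M : MatchedPair V H) where
  /-- the underlying set -/
  carrier : Type u
  /-- the grading -/
  deg : carrier → Arr V
  /-- the action `x ▷ e` -/
  act (x : Arr H) (e : carrier) (h : x.tgt = (deg e).src) : carrier
  src_deg_act (x : Arr H) (e : carrier) (h : x.tgt = (deg e).src) : (deg (act x e h)).src = x.src
  act_act (x y : Arr H) (e : carrier) (hxy : x.tgt = y.src) (h : y.tgt = (deg e).src) :
    act x (act y e h) (hxy.trans (src_deg_act y e h).symm) = act (x.comp y hxy) e h
  id_act (e : carrier) : act (Arr.id H (deg e).src) e rfl = e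
  deg_act (x : Arr H) (e : carrier) (h : x.tgt = (deg e).src) :
    deg (act x e h) = M.lact x (deg e) h

namespace Representation

variable {M : MatchedPair V H}

/-- The structure map `p : E → P`. -/
@[reducible] def p (E : Representation M) (e : E.carrier) : P := (E.deg e).src

/-- The structure map `q : E → P`. -/
@[reducible] def q (E : Representation M) (e : E.carrier) : P := (E.deg e).tgt

theorem act_congr (E : Representation M) {x y : Arr H} {e f : E.carrier} (hx : x = y) (he : e = f)
    (h : x.tgt = (E.deg e).src) : E.act x e h = E.act y f (by rw [← hx, ← he, h]) := by
  subst hx he; rfl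

/-- A morphism of representations preserves the gradings and intertwines the actions. -/
@[ext] structure Hom (E F : Representation M) where
  /-- the underlying map -/
  toFun : E.carrier → F.carrier
  deg_map (e : E.carrier) : F.deg (toFun e) = E.deg e
  map_act (x : Arr H) (e : E.carrier) (h : x.tgt = (E.deg e).src) :
    toFun (E.act x e h) = F.act x (toFun e) (h.trans (congrArg Arr.src (deg_map e)).symm)

/-- The category `Rep(V, H)`. -/
instance : Category (Representation M) where
  Hom := Hom
  id E := ⟨fun e => e, fun _ => rfl, fun _ _ _ => rfl⟩
  comp a b := ⟨fun e => b.toFun (a.toFun e), fun e => (b.deg_map _).trans (a.deg_map e),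
    fun x e h => by rw [a.map_act, b.map_act]⟩

@[ext] theorem hom_ext {E F : Representation M} {a b : E ⟶ F}
    (h : ∀ e, a.toFun e = b.toFun e) : a = b :=
  Hom.ext (funext h)

/-- An isomorphism from a pair of mutually inverse maps, one of which is a morphism. -/
def isoMk {E F : Representation M} (a : E ⟶ F) (b : F.carrier → E.carrier)
    (hab : ∀ e, b (a.toFun e) = e) (hba : ∀ f, a.toFun (b f) = f) : E ≅ F where
  hom := a
  inv := ⟨b, fun f => by rw [← a.deg_map, hba], fun x f h => by
    have h1 : x.tgt = (E.deg (b f)).src := by rw [← a.deg_map, hba, h]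
    rw [← hab (E.act x (b f) h1), a.map_act]
    exact congrArg b (F.act_congr rfl (hba f).symm h)⟩
  hom_inv_id := hom_ext hab
  inv_hom_id := hom_ext hba

/-- The tensor product: pairs `(e, f)` with `q e = p f`, degree `|e| |f|` and action
`x ▷ (e, f) = (x ▷ e, (x ◁ |e|) ▷ f)`. -/
def tensor (E F : Representation M) : Representation M where
  carrier := {z : E.carrier × F.carrier // E.q z.1 = F.p z.2}
  deg z := (E.deg z.1.1).comp (F.deg z.1.2) z.2
  act x z h := ⟨(E.act x z.1.1 h, F.act (M.ract x (E.deg z.1.1) h) z.1.2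
      ((M.tgt_ract x (E.deg z.1.1) h).trans z.2)), by
    show (E.deg (E.act _ _ _)).tgt = (F.deg (F.act _ _ _)).src
    rw [E.deg_act, F.src_deg_act, M.tgt_lact]⟩
  src_deg_act x z h := E.src_deg_act x z.1.1 h
  act_act x y z hxy h := by
    refine Subtype.ext (Prod.ext (E.act_act x y z.1.1 hxy h) ?_)
    refine (F.act_act _ _ _ ?_ _).trans (F.act_congr ?_ rfl _)
    · rw [M.tgt_ract, E.deg_act, M.tgt_lact]
    · simp only [E.deg_act]
      exact (M.comp_ract x y (E.deg z.1.1) hxy h).symm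
  id_act z := by
    refine Subtype.ext (Prod.ext (E.id_act z.1.1) ?_)
    refine (F.act_congr ?_ rfl _).trans (F.id_act z.1.2)
    exact (M.id_ract (E.deg z.1.1)).trans (congrArg (Arr.id H) z.2)
  deg_act x z h := by
    refine Eq.trans ?_ (M.lact_comp x (E.deg z.1.1) (F.deg z.1.2) h z.2).symm
    simp only [E.deg_act, F.deg_act]

/-- The unit object: the base `P`, with `|a| = id a` and `x ▷ r(x) = l(x)`. -/
def unit (M : MatchedPair V H) : Representation M where
  carrier := P
  deg a := Arr.id V a
  act x _ _ := x.src
  src_deg_act _ _ _ := rfl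
  act_act _ _ _ _ _ := rfl
  id_act _ := rfl
  deg_act x a h := (M.lact_id x a h).symm

/-- The tensor product of morphisms, `(e, f) ↦ (a e, b f)`. -/
def tensorMap {E E' F F' : Representation M} (a : E ⟶ E') (b : F ⟶ F') :
    tensor E F ⟶ tensor E' F' where
  toFun z := ⟨(a.toFun z.1.1, b.toFun z.1.2), by
    show (E'.deg _).tgt = (F'.deg _).src
    rw [a.deg_map, b.deg_map]; exact z.2⟩
  deg_map z := by
    simp only [tensor, a.deg_map, b.deg_map]
  map_act x z h := by
    refine Subtype.ext (Prod.ext (a.map_act x z.1.1 h) ?_)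
    refine (b.map_act _ _ _).trans (F'.act_congr ?_ rfl _)
    simp only [a.deg_map]

/-- The associativity constraint `((e, f), k) ↦ (e, (f, k))`. -/
def assoc (E F K : Representation M) : tensor (tensor E F) K ≅ tensor E (tensor F K) :=
  isoMk (E := tensor (tensor E F) K) (F := tensor E (tensor F K))
    { toFun := fun z => ⟨(z.1.1.1.1, ⟨(z.1.1.1.2, z.1.2), z.2⟩), z.1.1.2⟩
      deg_map := fun z => (Arr.comp_assoc _ _ _ _ _).symm
      map_act := fun x z h => by
        refine Subtype.ext (Prod.ext rfl (Subtype.ext (Prod.ext rfl ?_)))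
        exact K.act_congr (M.ract_ract _ _ _ _ _).symm rfl _ }
    (fun z => ⟨(⟨(z.1.1, z.1.2.1.1), z.2⟩, z.1.2.1.2), z.1.2.2⟩)
    (fun _ => rfl) (fun _ => rfl)

/-- The left unit constraint `(p e, e) ↦ e`. -/
def leftUnit (E : Representation M) : tensor (unit M) E ≅ E :=
  isoMk (E := tensor (unit M) E) (F := E)
    { toFun := fun z => z.1.2
      deg_map := fun _ => (Arr.id_comp _ _ _).symm
      map_act := fun _ _ _ => E.act_congr (M.ract_id' _ _ _) rfl _ }
    (fun e => ⟨(E.p e, e), rfl⟩)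
    (fun z => Subtype.ext (Prod.ext z.2.symm rfl)) (fun _ => rfl)

/-- The right unit constraint `(e, q e) ↦ e`. -/
def rightUnit (E : Representation M) : tensor E (unit M) ≅ E :=
  isoMk (E := tensor E (unit M)) (F := E)
    { toFun := fun z => z.1.1
      deg_map := fun _ => (Arr.comp_id _ _ _).symm
      map_act := fun _ _ _ => rfl }
    (fun e => ⟨(e, E.q e), rfl⟩)
    (fun z => Subtype.ext (Prod.ext rfl z.2)) (fun _ => rfl)

/-- The monoidal category `Rep(V, H)`. -/
instance : MonoidalCategory (Representation M) where
  tensorObj := tensor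
  whiskerLeft E _ _ b := tensorMap (𝟙 E) b
  whiskerRight a F := tensorMap a (𝟙 F)
  tensorHom a b := tensorMap a b
  tensorUnit := unit M
  associator := assoc
  leftUnitor := leftUnit
  rightUnitor := rightUnit

end Representation

/-- A rotation for a matched pair `(V, H)`: a morphism of groupoids `κ : V → H` over the base, with
`y κ(g) = κ(y ▷ g) (y ◁ g)` whenever the end of `y` is the source of `g`. -/
@[ext] structure Rotation (M : MatchedPair V H) where
  /-- the underlying map on arrows -/
  toFun : Arr V → Arr H
  src_map (g : Arr V) : (toFun g).src = g.src
  tgt_map (g : Arr V) : (toFun g).tgt = g.tgt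
  map_id (a : P) : toFun (Arr.id V a) = Arr.id H a
  map_comp (f g : Arr V) (h : f.tgt = g.src) :
    toFun (f.comp g h) =
      (toFun f).comp (toFun g) ((tgt_map f).trans (h.trans (src_map g).symm))
  comp_map (y : Arr H) (g : Arr V) (h : y.tgt = g.src) :
    y.comp (toFun g) (h.trans (src_map g).symm) =
      (toFun (M.lact y g h)).comp (M.ract y g h)
        ((tgt_map (M.lact y g h)).trans (M.tgt_lact y g h))

/-- A matched pair of rotations `(ξ, η)`: for all composable `g`, `f` in `V`, the vertical arrows
`η(g) ▷ f` and `ξ(f)⁻¹ ▷ g⁻¹` have the same end, and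
`(η(g) ▷ f) (ξ(f)⁻¹ ▷ g⁻¹)⁻¹ = g f`. -/
@[ext] structure RotationPair (M : MatchedPair V H) where
  /-- the rotation `ξ` -/
  ξ : Rotation M
  /-- the rotation `η` -/
  η : Rotation M
  tgt_eq (g f : Arr V) (h : g.tgt = f.src) :
    (M.lact (η.toFun g) f ((η.tgt_map g).trans h)).tgt =
      (M.lact (ξ.toFun f).inv g.inv ((ξ.src_map f).trans h.symm)).tgt
  comp_eq (g f : Arr V) (h : g.tgt = f.src) :
    (M.lact (η.toFun g) f ((η.tgt_map g).trans h)).comp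
      (M.lact (ξ.toFun f).inv g.inv ((ξ.src_map f).trans h.symm)).inv (tgt_eq g f h) =
        g.comp f h

end MatchedPair

end

/-!
A matched pair of rotations `(ξ, η)` gives the maps
`(e, d) ↦ (η(|e|) ▷ d, (ξ(|d|)⁻¹ ◁ |e|⁻¹) ▷ e)`. Every axiom of a braiding for them is an identity
between arrows of `H` that depends only on the degrees `g = |e|`, `f = |d|`. These identities follow
from the two relations `η(g) ◁ f = η(g')` (`RotationPair.eta_ract`) and
`ξ(η(g) ▷ f)⁻¹ = ξ(f)⁻¹ ◁ g⁻¹` (`RotationPair.inv_xi_lact_eta`), where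
`g' = (ξ(f)⁻¹ ◁ g⁻¹) ▷ g`. Invertibility needs no separate construction: `(η, ξ)` is again a
matched pair of rotations (`RotationPair.swap`), and its maps are inverse to those of `(ξ, η)`.

Conversely, the elements of degree `g` of a representation are the morphisms from the free
representation on a generator of degree `g`, whose underlying set consists of the arrows of `H`
ending at the source of `g`. By naturality a braiding is therefore determined by its values on
pairs of generators: it has the form `(e, d) ↦ (y ▷ d, z ▷ e)` with arrows `y = y(g, f)` and
`z = z(g, f)` of `H` (`Braiding.app_eq`). Comparing the action on generators turns `H`-equivariance
and the hexagons into identities between arrows. The first hexagon gives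
`y(g, f) = y(g, id)`, and the second gives `z(g, f) = z(id, f) ◁ g⁻¹`. So
`η(g) = y(g, id)` and `ξ(f) = z(id, f)⁻¹` recover the braiding; the other
components of the hexagons say that they are multiplicative, equivariance is the rotation identity,
and preservation of degrees is the compatibility of `ξ` with `η`.
-/

/-! ### Arrows, matched pairs and rotations -/

namespace Arr

variable {P : Type u} {G : Groupoid.{u} P}

theorem comp_congr {f f' g g' : Arr G} (hf : f = f') (hg : g = g') (h : f.tgt = g.src)
    (h' : f'.tgt = g'.src) : f.comp g h = f'.comp g' h' := by
  subst hf hg; rfl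

theorem inv_inv (f : Arr G) : f.inv.inv = f := by
  simp [inv]

theorem inv_id (p : P) : (id G p).inv = id G p := by
  simp [inv, id]

theorem comp_inv_rev (f g : Arr G) (h : f.tgt = g.src) :
    (f.comp g h).inv = g.inv.comp f.inv h.symm := by
  obtain ⟨a, b, f⟩ := f
  obtain ⟨c, d, g⟩ := g
  obtain rfl : b = c := h
  simp [inv, comp]

theorem inv_comp_cancel_left (f g : Arr G) (h : f.tgt = g.src) :
    f.inv.comp (f.comp g h) rfl = g := by
  rw [← comp_assoc _ _ _ rfl h]
  exact (comp_congr (inv_comp f) rfl _ h).trans (id_comp g _ h)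

theorem comp_inv_cancel_right (f g : Arr G) (h : f.tgt = g.src) :
    (f.comp g h).comp g.inv rfl = f := by
  rw [comp_assoc _ _ _ h rfl]
  exact (comp_congr rfl (comp_inv g) _ h).trans (comp_id f _ h)

theorem comp_left_cancel {f g g' : Arr G} (h : f.tgt = g.src) (h' : f.tgt = g'.src)
    (e : f.comp g h = f.comp g' h') : g = g' := by
  rw [← inv_comp_cancel_left f g h, ← inv_comp_cancel_left f g' h']
  exact comp_congr rfl e _ _

theorem comp_right_cancel {f f' g : Arr G} (h : f.tgt = g.src) (h' : f'.tgt = g.src)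
    (e : f.comp g h = f'.comp g h') : f = f' := by
  rw [← comp_inv_cancel_right f g h, ← comp_inv_cancel_right f' g h']
  exact comp_congr e rfl _ _

theorem eq_inv_of_comp_eq_id {f g : Arr G} (h : f.tgt = g.src) {p : P}
    (e : f.comp g h = id G p) : f = g.inv := by
  have hp : g.tgt = p := congrArg Arr.tgt e
  subst hp
  exact comp_right_cancel h rfl (e.trans (inv_comp g).symm)

/-- Moving factors across an equation `a b = c d`: then `c⁻¹ a = d b⁻¹`. -/
theorem inv_comp_eq_comp_inv {a b c d : Arr G} (hab : a.tgt = b.src) (hcd : c.tgt = d.src)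
    (e : a.comp b hab = c.comp d hcd) (h : c.src = a.src) (h' : d.tgt = b.tgt) :
    c.inv.comp a h = d.comp b.inv h' := by
  obtain ⟨p, m, a⟩ := a
  obtain ⟨m', q, b⟩ := b
  obtain ⟨p', n, c⟩ := c
  obtain ⟨n', q', d⟩ := d
  obtain rfl : m = m' := hab
  obtain rfl : n = n' := hcd
  obtain rfl : p' = p := h
  obtain rfl : q' = q := h'
  have e' : a ≫ b = c ≫ d := by simpa [comp] using e
  have e'' : Groupoid.inv c ≫ a = d ≫ Groupoid.inv b := by
    rw [Groupoid.inv_eq_inv, Groupoid.inv_eq_inv, IsIso.inv_comp_eq, ← Category.assoc, ← e']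
    simp
  simpa [comp, inv] using e''

end Arr

namespace MatchedPair

variable {P : Type u} {V H : Groupoid.{u} P} (M : MatchedPair V H)

theorem lact_congr {x y : Arr H} {f g : Arr V} (hx : x = y) (hf : f = g) (h : x.tgt = f.src)
    (h' : y.tgt = g.src) : M.lact x f h = M.lact y g h' := by
  subst hx hf; rfl

theorem ract_congr {x y : Arr H} {f g : Arr V} (hx : x = y) (hf : f = g) (h : x.tgt = f.src)
    (h' : y.tgt = g.src) : M.ract x f h = M.ract y g h' := by
  subst hx hf; rfl

theorem id_ract' (g : Arr V) (p : P) (h : p = g.src) :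
    M.ract (Arr.id H p) g h = Arr.id H g.tgt := by
  subst h; exact M.id_ract g

/-- `(x ◁ g) ▷ g⁻¹ = (x ▷ g)⁻¹` -/
theorem lact_inv (x : Arr H) (g : Arr V) (h : x.tgt = g.src) :
    M.lact (M.ract x g h) g.inv (M.tgt_ract x g h) = (M.lact x g h).inv := by
  have h1 := M.lact_comp x g g.inv h rfl
  rw [M.lact_congr rfl (Arr.comp_inv g) _ h, M.lact_id] at h1
  rw [← Arr.inv_inv (M.lact (M.ract x g h) _ _), ← Arr.eq_inv_of_comp_eq_id _ h1.symm]

/-- `(x ◁ g) ◁ g⁻¹ = x` -/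
theorem ract_ract_inv (x : Arr H) (g : Arr V) (h : x.tgt = g.src) :
    M.ract (M.ract x g h) g.inv (M.tgt_ract x g h) = x := by
  rw [M.ract_ract x g g.inv h rfl, M.ract_congr rfl (Arr.comp_inv g) _ h, M.ract_id']

/-- `x⁻¹ ◁ (x ▷ g) = (x ◁ g)⁻¹` -/
theorem inv_ract_lact (x : Arr H) (g : Arr V) (h : x.tgt = g.src) :
    M.ract x.inv (M.lact x g h) (M.src_lact x g h).symm = (M.ract x g h).inv := by
  have h1 := M.comp_ract x.inv x g rfl h
  rw [M.ract_congr (Arr.inv_comp x) rfl _ h, M.id_ract'] at h1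
  exact Arr.eq_inv_of_comp_eq_id _ h1.symm

/-- `(x ◁ g)⁻¹ ◁ (x ▷ g)⁻¹ = x⁻¹` -/
theorem inv_ract_ract_inv (x : Arr H) (g : Arr V) (h : x.tgt = g.src) :
    M.ract (M.ract x g h).inv (M.lact x g h).inv (M.tgt_lact x g h).symm = x.inv :=
  (M.ract_congr (M.inv_ract_lact x g h).symm rfl _ (M.tgt_ract _ _ _)).trans
    (M.ract_ract_inv _ _ _)

namespace Rotation

variable {M} (κ : Rotation M)

theorem map_inv (g : Arr V) : κ.toFun g.inv = (κ.toFun g).inv := by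
  have h1 := κ.map_comp g.inv g rfl
  rw [Arr.inv_comp g, κ.map_id] at h1
  exact Arr.eq_inv_of_comp_eq_id _ h1.symm

/-- The rotation identity in the form `κ(y ▷ g)⁻¹ y = (y ◁ g) κ(g)⁻¹`. -/
theorem inv_map_comp (y : Arr H) (g : Arr V) (h : y.tgt = g.src) :
    (κ.toFun (M.lact y g h)).inv.comp y ((κ.src_map _).trans (M.src_lact y g h)) =
      (M.ract y g h).comp (κ.toFun g).inv ((M.tgt_ract y g h).trans (κ.tgt_map g).symm) :=
  Arr.inv_comp_eq_comp_inv _ _ (κ.comp_map y g h) _ _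

end Rotation

namespace RotationPair

variable {M} (ρ : RotationPair M)

/-- The arrow `ξ(f)⁻¹ ◁ g⁻¹`, by which the braiding acts on an element of degree `g` when it is
moved past an element of degree `f`. -/
def coaction (g f : Arr V) (h : g.tgt = f.src) : Arr H :=
  M.ract (ρ.ξ.toFun f).inv g.inv ((ρ.ξ.src_map f).trans h.symm)

theorem coaction_congr {g g' f f' : Arr V} (hg : g = g') (hf : f = f') (h : g.tgt = f.src)
    (h' : g'.tgt = f'.src) : ρ.coaction g f h = ρ.coaction g' f' h' := by
  subst hg hf; rfl

theorem tgt_eta (g f : Arr V) (h : g.tgt = f.src) : (ρ.η.toFun g).tgt = f.src :=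
  (ρ.η.tgt_map g).trans h

theorem tgt_coaction (g f : Arr V) (h : g.tgt = f.src) : (ρ.coaction g f h).tgt = g.src :=
  M.tgt_ract _ _ _

theorem inv_xi_tgt (g f : Arr V) (h : g.tgt = f.src) : (ρ.ξ.toFun f).inv.tgt = g.inv.src :=
  (ρ.ξ.src_map f).trans h.symm

theorem coaction_lact (g f : Arr V) (h : g.tgt = f.src) :
    M.lact (ρ.coaction g f h) g (ρ.tgt_coaction g f h) =
      (M.lact (ρ.ξ.toFun f).inv g.inv (ρ.inv_xi_tgt g f h)).inv :=
  (M.lact_congr rfl (Arr.inv_inv g).symm _ _).trans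
    (M.lact_inv (ρ.ξ.toFun f).inv g.inv (ρ.inv_xi_tgt g f h))

theorem tgt_lact_eta (g f : Arr V) (h : g.tgt = f.src) :
    (M.lact (ρ.η.toFun g) f (ρ.tgt_eta g f h)).tgt = (ρ.coaction g f h).src :=
  (ρ.tgt_eq g f h).trans (M.tgt_lact _ _ _)

theorem lact_eta_tgt (g f : Arr V) (h : g.tgt = f.src) :
    (M.lact (ρ.η.toFun g) f (ρ.tgt_eta g f h)).tgt =
      (M.lact (ρ.coaction g f h) g (ρ.tgt_coaction g f h)).src :=
  (ρ.tgt_lact_eta g f h).trans (M.src_lact _ _ _).symm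

/-- The braiding preserves degrees. -/
theorem lact_eta_comp (g f : Arr V) (h : g.tgt = f.src) :
    (M.lact (ρ.η.toFun g) f (ρ.tgt_eta g f h)).comp
      (M.lact (ρ.coaction g f h) g (ρ.tgt_coaction g f h)) (ρ.lact_eta_tgt g f h) =
        g.comp f h :=
  (Arr.comp_congr rfl (ρ.coaction_lact g f h) _ (ρ.tgt_eq g f h)).trans (ρ.comp_eq g f h)

theorem lact_coaction_tgt (g f : Arr V) (h : g.tgt = f.src) :
    (M.lact (ρ.coaction g f h) g (ρ.tgt_coaction g f h)).tgt = f.tgt := by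
  have h1 := congrArg Arr.tgt (ρ.lact_eta_comp g f h)
  exact h1

/-- `η(g) ◁ f = η(g')`, where `g'` is the degree of the second component of the braiding. Both
sides are the right factor of `η(g) η(f)`, by the rotation identity and by multiplicativity. -/
theorem eta_ract (g f : Arr V) (h : g.tgt = f.src) :
    M.ract (ρ.η.toFun g) f (ρ.tgt_eta g f h) =
      ρ.η.toFun (M.lact (ρ.coaction g f h) g (ρ.tgt_coaction g f h)) := by
  have h1 := ρ.η.comp_map (ρ.η.toFun g) f (ρ.tgt_eta g f h)
  have h2 := ρ.η.map_comp g f h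
  rw [← ρ.lact_eta_comp g f h, ρ.η.map_comp] at h2
  exact Arr.comp_left_cancel _ _ (h1.symm.trans h2.symm)

/-- `ξ(η(g) ▷ f) = (ξ(f)⁻¹ ◁ g⁻¹)⁻¹` -/
theorem inv_xi_lact_eta (g f : Arr V) (h : g.tgt = f.src) :
    (ρ.ξ.toFun (M.lact (ρ.η.toFun g) f (ρ.tgt_eta g f h))).inv = ρ.coaction g f h := by
  have h1 := ρ.ξ.inv_map_comp (ρ.η.toFun g) f (ρ.tgt_eta g f h)
  have h2 := ρ.η.inv_map_comp (ρ.ξ.toFun f).inv g.inv (ρ.inv_xi_tgt g f h)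
  have h3 : ρ.η.toFun (M.lact (ρ.ξ.toFun f).inv g.inv (ρ.inv_xi_tgt g f h)) =
      (M.ract (ρ.η.toFun g) f (ρ.tgt_eta g f h)).inv := by
    rw [ρ.eta_ract g f h, ← ρ.η.map_inv, ρ.coaction_lact, Arr.inv_inv]
  refine Arr.comp_right_cancel (g := ρ.η.toFun g) _
    ((M.tgt_ract _ _ _).trans (ρ.η.src_map g).symm) (h1.trans ?_)
  · have h4 : ((ρ.η.toFun g.inv).inv) = ρ.η.toFun g := by rw [ρ.η.map_inv, Arr.inv_inv]
    refine (Arr.comp_congr ?_ rfl _ _).trans (h2.trans (Arr.comp_congr rfl h4 _ _))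
    rw [h3, Arr.inv_inv]

/-- Interchanging the two rotations of a matched pair gives a matched pair, because inverting the
defining identity for `(f⁻¹, g⁻¹)` exchanges their roles. The corresponding braidings are inverse
to each other. -/
def swap : RotationPair M where
  ξ := ρ.η
  η := ρ.ξ
  tgt_eq g f h := by
    have h1 := ρ.tgt_eq f.inv g.inv h.symm
    rw [M.lact_congr (ρ.η.map_inv f) rfl _ ((ρ.η.src_map f).trans h.symm),
      M.lact_congr (y := ρ.ξ.toFun g) (g := f)
        (by rw [ρ.ξ.map_inv, Arr.inv_inv]) (Arr.inv_inv f) _ ((ρ.ξ.tgt_map g).trans h)] at h1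
    exact h1.symm
  comp_eq g f h := by
    have h1 := congrArg Arr.inv (ρ.comp_eq f.inv g.inv h.symm)
    rw [Arr.comp_inv_rev, Arr.comp_inv_rev] at h1
    refine Eq.trans (Arr.comp_congr (Eq.trans ?_ (Arr.inv_inv _).symm)
      (congrArg Arr.inv (M.lact_congr (ρ.η.map_inv f).symm rfl _ _)) _ _)
      (h1.trans (Arr.comp_congr (Arr.inv_inv g) (Arr.inv_inv f) _ _))
    exact M.lact_congr (by rw [ρ.ξ.map_inv, Arr.inv_inv]) (Arr.inv_inv f).symm _ _

/-- The inverse braiding undoes the action of the braiding on the second argument. -/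
theorem swap_coaction (g f : Arr V) (h : g.tgt = f.src) :
    ρ.swap.coaction (M.lact (ρ.η.toFun g) f (ρ.tgt_eta g f h))
      (M.lact (ρ.coaction g f h) g (ρ.tgt_coaction g f h)) (ρ.lact_eta_tgt g f h) =
        (ρ.η.toFun g).inv :=
  (M.ract_congr (congrArg Arr.inv (ρ.eta_ract g f h).symm) rfl _ (M.tgt_lact _ _ _).symm).trans
    (M.inv_ract_ract_inv _ _ _)

/-- The identity between arrows of `H` by which the braiding commutes with the action of `H` on its
second component. For `g` an identity it is the rotation identity of `ξ`; acting on that by `g⁻¹`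
from the right gives the general case. -/
theorem coaction_comp (x : Arr H) (g f : Arr V) (h : g.tgt = f.src) (hx : x.tgt = g.src)
    (h1 : (M.ract x g hx).tgt = f.src) (h2 : (M.lact x g hx).tgt = (M.lact _ f h1).src)
    (h3 : (ρ.coaction (M.lact x g hx) (M.lact (M.ract x g hx) f h1) h2).tgt = x.src)
    (h5 : x.tgt = (M.lact (ρ.η.toFun g) f (ρ.tgt_eta g f h)).src)
    (h6 : (M.ract x _ h5).tgt = (ρ.coaction g f h).src) :
    (ρ.coaction (M.lact x g hx) (M.lact (M.ract x g hx) f h1) h2).comp x h3 =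
      (M.ract x (M.lact (ρ.η.toFun g) f (ρ.tgt_eta g f h)) h5).comp (ρ.coaction g f h) h6 := by
  have a1 := M.comp_ract (ρ.ξ.toFun (M.lact (M.ract x g hx) f h1)).inv (M.ract x g hx) g.inv
    ((ρ.ξ.src_map _).trans (M.src_lact _ _ _)) (M.tgt_ract _ _ _)
  rw [M.ract_congr (ρ.ξ.inv_map_comp (M.ract x g hx) f h1) rfl _
    ((ρ.ξ.src_map f).trans h.symm), M.comp_ract _ _ _ _ (ρ.inv_xi_tgt g f h)] at a1
  refine Eq.trans ?_ (a1.symm.trans ?_)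
  · refine Arr.comp_congr ?_ (M.ract_ract_inv _ _ _).symm _ _
    exact M.ract_congr rfl (M.lact_inv _ _ _).symm _ _
  · refine Arr.comp_congr ?_ rfl _ _
    -- `x ◁ (η(g) ▷ f)` and `(x ◁ g) ◁ f` differ by the factor in `comp_eq`
    have a2 := M.ract_congr rfl (ρ.comp_eq g f h) h5 hx
    rw [← M.ract_ract _ _ _ h5, ← M.ract_ract _ _ _ hx] at a2
    refine (M.ract_congr a2.symm (Arr.inv_inv _).symm _ ?_).trans (M.ract_ract_inv _ _ _)
    exact M.tgt_ract _ _ _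

/-- The first hexagon, for the factor that is moved past the two others. -/
theorem coaction_comp_right (e d f : Arr V) (h : e.tgt = d.src) (h' : d.tgt = f.src)
    (h1 : (M.lact (ρ.coaction e d h) e (ρ.tgt_coaction e d h)).tgt = f.src)
    (h2 : (ρ.coaction _ f h1).tgt = (ρ.coaction e d h).src) :
    (ρ.coaction _ f h1).comp (ρ.coaction e d h) h2 = ρ.coaction e (d.comp f h') h := by
  have a1 : (ρ.ξ.toFun (d.comp f h')).inv =
      (ρ.ξ.toFun f).inv.comp (ρ.ξ.toFun d).inv
        ((ρ.ξ.src_map f).trans (h'.symm.trans (ρ.ξ.tgt_map d).symm)) := by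
    rw [ρ.ξ.map_comp, Arr.comp_inv_rev]
  have a2 := M.comp_ract (ρ.ξ.toFun f).inv (ρ.ξ.toFun d).inv e.inv
    ((ρ.ξ.src_map f).trans (h'.symm.trans (ρ.ξ.tgt_map d).symm)) (ρ.inv_xi_tgt e d h)
  refine Eq.trans ?_ (a2.symm.trans (M.ract_congr a1.symm rfl _ _))
  refine Arr.comp_congr (M.ract_congr rfl ?_ _ _) rfl _ _
  rw [ρ.coaction_lact, Arr.inv_inv]

/-- The second hexagon, for the middle factor. -/
theorem coaction_comp_left_ract (e d f : Arr V) (h : e.tgt = d.src) (h' : d.tgt = f.src)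
    (h1 : (ρ.coaction (e.comp d h) f h').tgt = e.src) :
    M.ract (ρ.coaction (e.comp d h) f h') e h1 = ρ.coaction d f h' := by
  have a1 := M.ract_ract (ρ.ξ.toFun f).inv d.inv e.inv (ρ.inv_xi_tgt d f h') h.symm
  have a2 : ρ.coaction (e.comp d h) f h' = _ :=
    (M.ract_congr rfl (Arr.comp_inv_rev e d h) _ _).trans a1.symm
  refine (M.ract_congr a2 (Arr.inv_inv e).symm _ ?_).trans (M.ract_ract_inv _ _ _)
  exact M.tgt_ract _ _ _

/-- The second hexagon, for the left factor. -/
theorem coaction_comp_left (e d f : Arr V) (h : e.tgt = d.src) (h' : d.tgt = f.src)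
    (h1 : e.tgt = (M.lact (ρ.η.toFun d) f (ρ.tgt_eta d f h')).src) :
    ρ.coaction (e.comp d h) f h' = ρ.coaction e _ h1 := by
  have a1 := M.ract_ract (ρ.ξ.toFun f).inv d.inv e.inv (ρ.inv_xi_tgt d f h') h.symm
  refine ((M.ract_congr rfl (Arr.comp_inv_rev e d h) _ _).trans a1.symm).trans ?_
  exact M.ract_congr (ρ.inv_xi_lact_eta d f h').symm rfl _ _

end RotationPair
end MatchedPair

/-! ### The braiding of a matched pair of rotations -/

namespace MatchedPair

variable {P : Type u} {V H : Groupoid.{u} P} {M : MatchedPair V H}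

namespace RotationPair

open MatchedPair.Representation

variable (ρ : RotationPair M)

theorem coaction_tgt_of_act {E D : Representation M} (z : (tensor E D).carrier) :
    (D.deg (D.act (ρ.η.toFun (E.deg z.1.1)) z.1.2 (ρ.tgt_eta _ _ z.2))).tgt =
      (E.deg (E.act (ρ.coaction (E.deg z.1.1) (D.deg z.1.2) z.2) z.1.1
        (ρ.tgt_coaction _ _ z.2))).src := by
  rw [D.deg_act, E.deg_act]
  exact ρ.lact_eta_tgt _ _ z.2

/-- The morphism `(e, d) ↦ (η(|e|) ▷ d, (ξ(|d|)⁻¹ ◁ |e|⁻¹) ▷ e)`. -/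
def braidingHom (E D : Representation M) : tensor E D ⟶ tensor D E where
  toFun z := ⟨(D.act (ρ.η.toFun (E.deg z.1.1)) z.1.2 (ρ.tgt_eta _ _ z.2),
    E.act (ρ.coaction (E.deg z.1.1) (D.deg z.1.2) z.2) z.1.1 (ρ.tgt_coaction _ _ z.2)),
    ρ.coaction_tgt_of_act z⟩
  deg_map z :=
    (Arr.comp_congr (D.deg_act _ _ _) (E.deg_act _ _ _) _ (ρ.lact_eta_tgt _ _ z.2)).trans
      (ρ.lact_eta_comp _ _ z.2)
  map_act x z h := by
    refine Subtype.ext (Prod.ext ?_ ?_)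
    · refine (D.act_act _ _ _ ?_ _).trans
        ((D.act_congr ?_ rfl _).trans (D.act_act _ _ _ (h.trans (ρ.η.src_map (E.deg z.1.1)).symm) (ρ.tgt_eta _ _ z.2)).symm)
      · exact (ρ.η.tgt_map _).trans ((congrArg Arr.tgt (E.deg_act _ _ _)).trans (M.tgt_lact _ _ _))
      · refine Eq.trans ?_ (ρ.η.comp_map x (E.deg z.1.1) h).symm
        exact Arr.comp_congr (congrArg _ (E.deg_act _ _ _)) rfl _ _
    · refine (E.act_act _ _ _ ?_ _).trans
        ((E.act_congr ?_ rfl _).trans (E.act_act _ _ _ ?_ _).symm)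
      · exact (ρ.tgt_coaction _ _ _).trans (E.src_deg_act _ _ _)
      · have h1 : (M.ract x (E.deg z.1.1) h).tgt = (D.deg z.1.2).src :=
          (M.tgt_ract _ _ _).trans z.2
        have h2 : (M.lact x (E.deg z.1.1) h).tgt = (M.lact _ (D.deg z.1.2) h1).src :=
          (M.tgt_lact _ _ _).trans (M.src_lact _ _ _).symm
        have h3 := (ρ.tgt_coaction _ _ h2).trans (M.src_lact x (E.deg z.1.1) h)
        have h4 := h.trans ((ρ.η.src_map (E.deg z.1.1)).symm.trans
          (M.src_lact _ (D.deg z.1.2) (ρ.tgt_eta _ _ z.2)).symm)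
        have h5 := (M.tgt_ract _ _ h4).trans (ρ.tgt_lact_eta _ _ z.2)
        exact (Arr.comp_congr (ρ.coaction_congr (E.deg_act _ _ _) (D.deg_act _ _ _) _ h2)
          rfl _ h3).trans ((ρ.coaction_comp x _ _ z.2 h h1 h2 h3 h4 h5).trans
            (Arr.comp_congr (M.ract_congr rfl (D.deg_act _ _ _).symm _ _) rfl _ _))
      · refine (M.tgt_ract _ _ _).trans ((congrArg Arr.tgt (D.deg_act _ _ _)).trans ?_)
        exact ρ.tgt_lact_eta _ _ z.2

/-- The morphism of the interchanged pair is inverse to that of the pair. -/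
theorem swap_braidingHom_braidingHom (E D : Representation M) (z : (tensor E D).carrier) :
    (ρ.swap.braidingHom D E).toFun ((ρ.braidingHom E D).toFun z) = z := by
  refine Subtype.ext (Prod.ext ?_ ?_)
  · have h1 : ρ.ξ.toFun (D.deg (D.act _ z.1.2 (ρ.tgt_eta _ _ z.2))) =
        (ρ.coaction (E.deg z.1.1) (D.deg z.1.2) z.2).inv := by
      rw [← ρ.inv_xi_lact_eta _ _ z.2, Arr.inv_inv, D.deg_act]
    refine (E.act_act _ _ _ (congrArg Arr.tgt h1) _).trans
      ((E.act_congr ?_ rfl _).trans (E.id_act _))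
    refine (Arr.comp_congr h1 rfl _ rfl).trans ((Arr.inv_comp _).trans ?_)
    rw [ρ.tgt_coaction]
  · have h1 := (ρ.swap.coaction_congr (D.deg_act _ _ (ρ.tgt_eta _ _ z.2))
      (E.deg_act _ _ (ρ.tgt_coaction _ _ z.2)) (ρ.coaction_tgt_of_act z) _).trans
        (ρ.swap_coaction _ _ z.2)
    refine (D.act_act _ _ _ (congrArg Arr.tgt h1) _).trans
      ((D.act_congr ?_ rfl _).trans (D.id_act _))
    refine (Arr.comp_congr h1 rfl _ rfl).trans ((Arr.inv_comp _).trans ?_)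
    rw [ρ.tgt_eta _ _ z.2]

/-- The braiding on `Rep(V, H)` given by a matched pair of rotations. -/
@[reducible] def toBraided : BraidedCategory (Representation M) where
  braiding E D := isoMk (E := tensor E D) (F := tensor D E) (ρ.braidingHom E D)
    (ρ.swap.braidingHom D E).toFun (ρ.swap_braidingHom_braidingHom E D)
    (ρ.swap.swap_braidingHom_braidingHom D E)
  braiding_naturality_right E D D' b := by
    apply Representation.hom_ext
    intro z
    refine Subtype.ext (Prod.ext ?_ ?_)
    · exact (b.map_act _ _ _).symm
    · exact E.act_congr (ρ.coaction_congr rfl (b.deg_map _) _ _) rfl _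
  braiding_naturality_left {E E'} a D := by
    apply Representation.hom_ext
    intro z
    refine Subtype.ext (Prod.ext ?_ ?_)
    · exact D.act_congr (congrArg _ (a.deg_map _)) rfl _
    · refine Eq.trans ?_ (a.map_act _ _ _).symm
      exact E'.act_congr (ρ.coaction_congr (a.deg_map _) rfl _ _) rfl _
  hexagon_forward E D F := by
    apply Representation.hom_ext
    intro z
    refine Subtype.ext (Prod.ext ?_ (Subtype.ext (Prod.ext ?_ ?_)))
    · rfl
    · refine F.act_congr ?_ rfl _
      exact (ρ.eta_ract _ _ _).trans (congrArg _ (E.deg_act _ _ _).symm)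
    · have h2 := (ρ.lact_coaction_tgt _ _ z.1.1.2).trans z.2
      have h3 := (ρ.tgt_coaction _ _ h2).trans (M.src_lact _ _ _)
      have h1 := ρ.coaction_congr (E.deg_act _ _ (ρ.tgt_coaction _ _ z.1.1.2)) rfl
        ((congrArg Arr.tgt (E.deg_act _ _ _)).trans h2) h2
      refine Eq.trans ?_ (E.act_act _ _ _ ((congrArg Arr.tgt h1).trans h3) _).symm
      refine E.act_congr ?_ rfl _
      exact (ρ.coaction_comp_right _ (D.deg z.1.1.1.2) _ _ z.2 h2 h3).symm.trans
        (Arr.comp_congr h1.symm rfl _ _)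
  hexagon_reverse E D F := by
    apply Representation.hom_ext
    intro z
    have h1 : (D.deg z.1.2.1.1).tgt = (F.deg z.1.2.1.2).src := z.1.2.2
    have h2 : (E.deg z.1.1).tgt = (D.deg z.1.2.1.1).src := z.2
    have h3 : (E.deg z.1.1).tgt = (ρ.η.toFun (D.deg z.1.2.1.1)).src :=
      h2.trans (ρ.η.src_map _).symm
    refine Subtype.ext (Prod.ext (Subtype.ext (Prod.ext ?_ ?_)) ?_)
    · refine Eq.trans ?_ (F.act_act _ _ _ ((ρ.η.tgt_map _).trans h3) (ρ.tgt_eta _ _ h1)).symm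
      exact F.act_congr (ρ.η.map_comp _ _ _) rfl _
    · refine E.act_congr ?_ rfl _
      exact (ρ.coaction_comp_left _ _ _ h2 h1 (h3.trans (M.src_lact _ _ _).symm)).trans
        (ρ.coaction_congr rfl (F.deg_act _ _ _).symm _ _)
    · refine D.act_congr ?_ rfl _
      exact ρ.coaction_comp_left_ract _ _ _ _ _ _

end RotationPair
end MatchedPair

/-! ### Free representations and the arrows attached to a braiding -/

namespace MatchedPair

variable {P : Type u} {V H : Groupoid.{u} P} {M : MatchedPair V H}

namespace Representation

/-- The free representation on one generator of degree `g`: the arrows of `H` that end at the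
source of `g`, an arrow `x` standing for `x` acting on the generator. -/
def free (M : MatchedPair V H) (g : Arr V) : Representation M where
  carrier := {x : Arr H // x.tgt = g.src}
  deg x := M.lact x.1 g x.2
  act y x h := ⟨y.comp x.1 (h.trans (M.src_lact _ _ _)), x.2⟩
  src_deg_act _ _ _ := M.src_lact _ _ _
  act_act _ _ _ _ _ := Subtype.ext (Arr.comp_assoc _ _ _ _ _).symm
  id_act _ := Subtype.ext (Arr.id_comp _ _ _)
  deg_act _ _ _ := (M.lact_lact _ _ _ _ _).symm

/-- The generator of the free representation. -/
def gen (M : MatchedPair V H) (g : Arr V) : (free M g).carrier := ⟨Arr.id H g.src, rfl⟩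

theorem deg_gen (g : Arr V) : (free M g).deg (gen M g) = g := M.id_lact g

theorem free_act_gen (g : Arr V) (x : Arr H) (h : x.tgt = ((free M g).deg (gen M g)).src) :
    ((free M g).act x (gen M g) h).1 = x :=
  Arr.comp_id _ _ _

/-- The morphism out of the free representation that sends the generator to a given element. -/
def lift (E : Representation M) (e : E.carrier) : free M (E.deg e) ⟶ E where
  toFun x := E.act x.1 e x.2
  deg_map _ := E.deg_act _ _ _
  map_act _ _ _ := (E.act_act _ _ _ _ _).symm

theorem lift_gen (E : Representation M) (e : E.carrier) : (lift E e).toFun (gen M _) = e :=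
  E.id_act e

/-- The pair of generators in the tensor product of two free representations. -/
def genPair (M : MatchedPair V H) (g f : Arr V) (h : g.tgt = f.src) :
    (tensor (free M g) (free M f)).carrier :=
  ⟨(gen M g, gen M f), by
    show ((free M g).deg (gen M g)).tgt = ((free M f).deg (gen M f)).src
    rw [deg_gen, deg_gen, h]⟩

end Representation

open MatchedPair.Representation

namespace Braiding

variable (B : BraidedCategory (Representation M))

/-- The underlying map of a braiding. -/
def app (E D : Representation M) (z : (tensor E D).carrier) : (tensor D E).carrier :=
  (B.braiding E D).hom.toFun z

/-- The arrow `y` such that a braiding sends `(e, d)` to `(y ▷ d, z ▷ e)` when the degrees of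
`e` and `d` are `g` and `f`; it is read off from the generators of free representations. -/
def fst (g f : Arr V) (h : g.tgt = f.src) : Arr H :=
  (app B (free M g) (free M f) (genPair M g f h)).1.1.1

/-- The arrow `z` such that a braiding sends `(e, d)` to `(y ▷ d, z ▷ e)` when the degrees of
`e` and `d` are `g` and `f`. -/
def snd (g f : Arr V) (h : g.tgt = f.src) : Arr H :=
  (app B (free M g) (free M f) (genPair M g f h)).1.2.1

theorem fst_congr {g g' f f' : Arr V} (hg : g = g') (hf : f = f') (h : g.tgt = f.src)
    (h' : g'.tgt = f'.src) : fst B g f h = fst B g' f' h' := by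
  subst hg hf; rfl

theorem snd_congr {g g' f f' : Arr V} (hg : g = g') (hf : f = f') (h : g.tgt = f.src)
    (h' : g'.tgt = f'.src) : snd B g f h = snd B g' f' h' := by
  subst hg hf; rfl

theorem tgt_fst (g f : Arr V) (h : g.tgt = f.src) : (fst B g f h).tgt = f.src :=
  (app B (free M g) (free M f) (genPair M g f h)).1.1.2

theorem tgt_snd (g f : Arr V) (h : g.tgt = f.src) : (snd B g f h).tgt = g.src :=
  (app B (free M g) (free M f) (genPair M g f h)).1.2.2

theorem lact_fst_tgt (g f : Arr V) (h : g.tgt = f.src) :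
    (M.lact (fst B g f h) f (tgt_fst B g f h)).tgt =
      (M.lact (snd B g f h) g (tgt_snd B g f h)).src :=
  (app B (free M g) (free M f) (genPair M g f h)).2

theorem lact_fst_comp (g f : Arr V) (h : g.tgt = f.src) :
    (M.lact (fst B g f h) f (tgt_fst B g f h)).comp (M.lact (snd B g f h) g (tgt_snd B g f h))
      (lact_fst_tgt B g f h) = g.comp f h :=
  ((B.braiding (free M g) (free M f)).hom.deg_map (genPair M g f h)).trans
    (Arr.comp_congr (deg_gen g) (deg_gen f) _ _)

theorem src_fst (g f : Arr V) (h : g.tgt = f.src) : (fst B g f h).src = g.src := by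
  have h1 := congrArg Arr.src (lact_fst_comp B g f h)
  exact (M.src_lact _ _ (tgt_fst B g f h)).symm.trans h1

/-- By naturality, a braiding is determined by its values on the generators of free
representations. -/
theorem app_eq (E D : Representation M) (e : E.carrier) (d : D.carrier) (h : E.q e = D.p d) :
    (app B E D ⟨(e, d), h⟩).1 =
      (D.act (fst B (E.deg e) (D.deg d) h) d (tgt_fst B _ _ h),
        E.act (snd B (E.deg e) (D.deg d) h) e (tgt_snd B _ _ h)) := by
  have h1 := congrArg (fun k : tensor (free M (E.deg e)) (free M (D.deg d)) ⟶ tensor D E =>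
    (Hom.toFun k (genPair M (E.deg e) (D.deg d) h)).1)
    (@BraidedCategory.braiding_naturality _ _ _ B _ _ _ _ (lift E e) (lift D d))
  refine Eq.trans (congrArg (fun z => (app B E D z).1) ?_) h1
  exact Subtype.ext (Prod.ext (lift_gen E e).symm (lift_gen D d).symm)

theorem app_fst (E D : Representation M) (z : (tensor E D).carrier) :
    (app B E D z).1.1 = D.act (fst B (E.deg z.1.1) (D.deg z.1.2) z.2) z.1.2 (tgt_fst B _ _ z.2) :=
  congrArg Prod.fst (app_eq B E D z.1.1 z.1.2 z.2)

theorem app_snd (E D : Representation M) (z : (tensor E D).carrier) :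
    (app B E D z).1.2 = E.act (snd B (E.deg z.1.1) (D.deg z.1.2) z.2) z.1.1 (tgt_snd B _ _ z.2) :=
  congrArg Prod.snd (app_eq B E D z.1.1 z.1.2 z.2)

end Braiding
end MatchedPair

/-! ### Equivariance and the hexagons in terms of arrows -/

namespace MatchedPair

variable {P : Type u} {V H : Groupoid.{u} P} {M : MatchedPair V H}

open MatchedPair.Representation

namespace Braiding

variable (B : BraidedCategory (Representation M))

/-- In every degree there is an element of a representation on which distinct arrows of `H` act
differently, namely the generator of the free representation. -/
theorem exists_faithful (M : MatchedPair V H) (g : Arr V) :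
    ∃ (E : Representation M) (e : E.carrier), E.deg e = g ∧
      ∀ (x y : Arr H) (hx : x.tgt = (E.deg e).src) (hy : y.tgt = (E.deg e).src),
        E.act x e hx = E.act y e hy → x = y :=
  ⟨free M g, gen M g, deg_gen g, fun x y hx hy h => by
    rw [← free_act_gen g x hx, h, free_act_gen]⟩

theorem src_snd (g f : Arr V) (h : g.tgt = f.src) :
    (snd B g f h).src = (M.lact (fst B g f h) f (tgt_fst B g f h)).tgt :=
  (M.src_lact _ _ _).symm.trans (lact_fst_tgt B g f h).symm

section Action

variable (x : Arr H) (g f : Arr V) (h : g.tgt = f.src) (hx : x.tgt = g.src)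

theorem fst_comp (h1 : (M.ract x g hx).tgt = f.src)
    (h2 : (M.lact x g hx).tgt = (M.lact (M.ract x g hx) f h1).src) :
    (fst B (M.lact x g hx) (M.lact (M.ract x g hx) f h1) h2).comp (M.ract x g hx)
        ((tgt_fst B _ _ h2).trans (M.src_lact _ _ _)) =
      x.comp (fst B g f h) (hx.trans (src_fst B g f h).symm) := by
  obtain ⟨E, e, rfl, -⟩ := exists_faithful M g
  obtain ⟨D, d, rfl, hd⟩ := exists_faithful M f
  have hx' := hx.trans (src_fst B _ _ h).symm
  have a0 := (B.braiding E D).hom.map_act x ⟨(e, d), h⟩ hx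
  have a1 := (app_fst B E D _).symm.trans (congrArg (fun z => z.1.1) a0)
  have a2 : _ = D.act x (D.act _ d (tgt_fst B _ _ h)) _ :=
    a1.trans (D.act_congr rfl (app_fst B E D ⟨(e, d), h⟩) _)
  refine hd _ _ h1 (tgt_fst B _ _ h) (Eq.trans ?_ (a2.trans (D.act_act _ _ _ hx' _)))
  refine (D.act_act _ _ _ _ _).symm.trans (D.act_congr ?_ rfl _)
  exact fst_congr B (E.deg_act _ _ _).symm (D.deg_act _ _ _).symm _ _

theorem snd_comp (h1 : (M.ract x g hx).tgt = f.src)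
    (h2 : (M.lact x g hx).tgt = (M.lact (M.ract x g hx) f h1).src)
    (h3 : x.tgt = (M.lact (fst B g f h) f (tgt_fst B g f h)).src) :
    (snd B (M.lact x g hx) (M.lact (M.ract x g hx) f h1) h2).comp x
        ((tgt_snd B _ _ h2).trans (M.src_lact _ _ _)) =
      (M.ract x _ h3).comp (snd B g f h) ((M.tgt_ract _ _ _).trans (src_snd B g f h).symm) := by
  obtain ⟨E, e, rfl, he⟩ := exists_faithful M g
  obtain ⟨D, d, rfl, -⟩ := exists_faithful M f
  have hx' := (M.tgt_ract x _ h3).trans (src_snd B _ _ h).symm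
  have a0 := (B.braiding E D).hom.map_act x ⟨(e, d), h⟩ hx
  have a1 := (app_snd B E D _).symm.trans (congrArg (fun z => z.1.2) a0)
  have a3 : D.deg (app B E D ⟨(e, d), h⟩).1.1 = _ :=
    (congrArg D.deg (app_fst B E D ⟨(e, d), h⟩)).trans (D.deg_act _ _ _)
  have a2 : _ = E.act _ (E.act _ e (tgt_snd B _ _ h)) _ :=
    a1.trans (E.act_congr (M.ract_congr rfl a3 _ h3) (app_snd B E D ⟨(e, d), h⟩) _)
  refine he _ _ hx (tgt_snd B _ _ h) (Eq.trans ?_ (a2.trans (E.act_act _ _ _ hx' _)))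
  refine (E.act_act _ _ _ _ _).symm.trans (E.act_congr ?_ rfl _)
  exact snd_congr B (E.deg_act _ _ _).symm (D.deg_act _ _ _).symm _ _

end Action

section Hexagon

variable (e d f : Arr V) (h : e.tgt = d.src) (h' : d.tgt = f.src)

theorem fst_comp_right : fst B e (d.comp f h') h = fst B e d h := by
  obtain ⟨E, e, rfl, -⟩ := exists_faithful M e
  obtain ⟨D, d, rfl, hd⟩ := exists_faithful M d
  obtain ⟨F, f, rfl, -⟩ := exists_faithful M f
  have a0 := congrArg (fun k : tensor (tensor E D) F ⟶ tensor D (tensor F E) =>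
    (Hom.toFun k ⟨(⟨(e, d), h⟩, f), h'⟩).1.1) (B.hexagon_forward E D F)
  have a1 := congrArg (fun z => z.1.1) (app_fst B E (tensor D F) ⟨(e, ⟨(d, f), h'⟩), h⟩)
  exact hd _ _ (tgt_fst B _ _ _) (tgt_fst B _ _ h)
    (a1.symm.trans (a0.trans (app_fst B E D ⟨(e, d), h⟩)))

theorem snd_comp_right (h1 : (M.lact (snd B e d h) e (tgt_snd B e d h)).tgt = f.src)
    (h2 : (snd B _ f h1).tgt = (snd B e d h).src) :
    snd B e (d.comp f h') h = (snd B _ f h1).comp (snd B e d h) h2 := by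
  obtain ⟨E, e, rfl, he⟩ := exists_faithful M e
  obtain ⟨D, d, rfl, -⟩ := exists_faithful M d
  obtain ⟨F, f, rfl, -⟩ := exists_faithful M f
  have a0 := congrArg (fun k : tensor (tensor E D) F ⟶ tensor D (tensor F E) =>
    (Hom.toFun k ⟨(⟨(e, d), h⟩, f), h'⟩).1.2.1.2) (B.hexagon_forward E D F)
  have a1 := app_snd B E (tensor D F) ⟨(e, ⟨(d, f), h'⟩), h⟩
  have a2 := app_snd B E D ⟨(e, d), h⟩
  have a3 : E.deg (app B E D ⟨(e, d), h⟩).1.2 = _ :=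
    (congrArg E.deg a2).trans (E.deg_act _ _ _)
  have h4 : (E.deg (app B E D ⟨(e, d), h⟩).1.2).tgt = (F.deg f).src :=
    (congrArg Arr.tgt a3).trans h1
  have a4 := app_snd B E F ⟨((app B E D ⟨(e, d), h⟩).1.2, f), h4⟩
  refine he _ _ (tgt_snd B _ _ _) (tgt_snd B _ _ h) (a1.symm.trans (a0.trans (a4.trans ?_)))
  refine Eq.trans ?_ (E.act_act _ _ _ h2 _)
  exact E.act_congr (snd_congr B a3 rfl _ _) a2 _

theorem fst_comp_left (h1 : e.tgt = (M.lact (fst B d f h') f (tgt_fst B d f h')).src)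
    (h2 : (fst B e _ h1).tgt = (fst B d f h').src) :
    fst B (e.comp d h) f h' = (fst B e _ h1).comp (fst B d f h') h2 := by
  obtain ⟨E, e, rfl, -⟩ := exists_faithful M e
  obtain ⟨D, d, rfl, -⟩ := exists_faithful M d
  obtain ⟨F, f, rfl, hf⟩ := exists_faithful M f
  have a0 := congrArg (fun k : tensor E (tensor D F) ⟶ tensor (tensor F E) D =>
    (Hom.toFun k ⟨(e, ⟨(d, f), h'⟩), h⟩).1.1.1.1) (B.hexagon_reverse E D F)
  have a1 := app_fst B (tensor E D) F ⟨(⟨(e, d), h⟩, f), h'⟩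
  have a2 := app_fst B D F ⟨(d, f), h'⟩
  have a3 : F.deg (app B D F ⟨(d, f), h'⟩).1.1 = _ :=
    (congrArg F.deg a2).trans (F.deg_act _ _ _)
  have h4 : (E.deg e).tgt = (F.deg (app B D F ⟨(d, f), h'⟩).1.1).src :=
    h1.trans (congrArg Arr.src a3).symm
  have a4 := app_fst B E F ⟨(e, (app B D F ⟨(d, f), h'⟩).1.1), h4⟩
  refine hf _ _ (tgt_fst B _ _ _) (tgt_fst B _ _ h') (a1.symm.trans (a0.trans (a4.trans ?_)))
  refine Eq.trans ?_ (F.act_act _ _ _ h2 _)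
  exact F.act_congr (fst_congr B rfl a3 _ _) a2 _

theorem snd_comp_left_ract (h1 : (snd B (e.comp d h) f h').tgt = e.src) :
    M.ract (snd B (e.comp d h) f h') e h1 = snd B d f h' := by
  obtain ⟨E, e, rfl, -⟩ := exists_faithful M e
  obtain ⟨D, d, rfl, hd⟩ := exists_faithful M d
  obtain ⟨F, f, rfl, -⟩ := exists_faithful M f
  have a0 := congrArg (fun k : tensor E (tensor D F) ⟶ tensor (tensor F E) D =>
    (Hom.toFun k ⟨(e, ⟨(d, f), h'⟩), h⟩).1.2) (B.hexagon_reverse E D F)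
  have a1 := congrArg (fun z => z.1.2) (app_snd B (tensor E D) F ⟨(⟨(e, d), h⟩, f), h'⟩)
  exact hd _ _ ((M.tgt_ract _ _ _).trans h) (tgt_snd B _ _ h')
    (a1.symm.trans (a0.trans (app_snd B D F ⟨(d, f), h'⟩)))

end Hexagon

end Braiding
end MatchedPair

/-! ### The matched pair of rotations of a braiding -/

namespace MatchedPair

variable {P : Type u} {V H : Groupoid.{u} P} {M : MatchedPair V H}

open MatchedPair.Representation

namespace Braiding

variable (B : BraidedCategory (Representation M))

/-- The first arrow does not depend on the degree of the second argument. -/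
theorem fst_eq (g f : Arr V) (h : g.tgt = f.src) :
    fst B g f h = fst B g (Arr.id V g.tgt) rfl :=
  (fst_congr B rfl (Arr.id_comp f _ h).symm h rfl).trans
    (fst_comp_right B g (Arr.id V g.tgt) f rfl h)

/-- The second arrow is determined by the one for an identity in the first argument. -/
theorem snd_eq (g f : Arr V) (h : g.tgt = f.src) :
    snd B g f h = M.ract (snd B (Arr.id V f.src) f rfl) g.inv ((tgt_snd B _ _ _).trans h.symm) := by
  rw [← snd_comp_left_ract B g.inv g f rfl h (tgt_snd B _ _ _)]
  refine M.ract_congr (snd_congr B ?_ rfl _ _) rfl _ _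
  rw [Arr.inv_comp, h]

/-- The second hexagon makes this arrow idempotent. -/
theorem fst_id (a : P) (f : Arr V) (h : a = f.src) : fst B (Arr.id V a) f h = Arr.id H a := by
  subst h
  have h1 := fst_comp_left B (Arr.id V f.src) (Arr.id V f.src) f rfl rfl
    ((src_fst B (Arr.id V f.src) f rfl).symm.trans (M.src_lact _ _ _).symm)
    ((tgt_fst B _ _ _).trans (M.src_lact _ _ _))
  have h2 := (fst_congr B (Arr.comp_id _ _ rfl).symm rfl rfl rfl).trans h1
  have h3 := h2.trans (Arr.comp_congr ((fst_eq B _ _ _).trans (fst_eq B _ f rfl).symm) rfl _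
    ((tgt_fst B (Arr.id V f.src) f rfl).trans (src_fst B (Arr.id V f.src) f rfl).symm))
  exact (Arr.eq_id_of_comp_self _ _ h3.symm).trans (congrArg _ (src_fst B _ _ _))

theorem src_snd_id (f : Arr V) : (snd B (Arr.id V f.src) f rfl).src = f.tgt := by
  rw [src_snd, M.lact_congr (fst_id B _ _ _) rfl _ rfl, M.id_lact]

theorem snd_id_comp (f g : Arr V) (h : f.tgt = g.src) :
    snd B (Arr.id V f.src) (f.comp g h) rfl =
      (snd B (Arr.id V g.src) g rfl).comp (snd B (Arr.id V f.src) f rfl)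
        ((tgt_snd B _ _ _).trans (h.symm.trans (src_snd_id B f).symm)) := by
  have h1 : M.lact (snd B (Arr.id V f.src) f rfl) (Arr.id V f.src) (tgt_snd B _ _ _) =
      Arr.id V g.src := by
    rw [M.lact_id, src_snd_id, h]
  have h2 := (congrArg Arr.tgt h1)
  refine (snd_comp_right B (Arr.id V f.src) f g rfl h h2 ?_).trans
    (Arr.comp_congr (snd_congr B h1 rfl _ _) rfl _ _)
  rw [tgt_snd, M.src_lact]

theorem snd_id_id (a : P) : snd B (Arr.id V a) (Arr.id V a) rfl = Arr.id H a := by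
  have h1 := snd_id_comp B (Arr.id V a) (Arr.id V a) rfl
  have h2 := (snd_congr B rfl (Arr.comp_id _ _ rfl).symm rfl rfl).trans h1
  exact (Arr.eq_id_of_comp_self _ _ h2.symm).trans (congrArg _ (src_snd_id B (Arr.id V a)))

/-- Equivariance at an element of identity degree is the rotation identity for `ξ`. -/
theorem snd_id_comp_ract (x : Arr H) (f : Arr V) (h : x.tgt = f.src) :
    (snd B (Arr.id V (M.lact x f h).src) (M.lact x f h) rfl).comp x
        ((tgt_snd B _ _ _).trans (M.src_lact x f h)) =
      (M.ract x f h).comp (snd B (Arr.id V f.src) f rfl)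
        ((M.tgt_ract x f h).trans (src_snd_id B f).symm) := by
  have a1 : M.ract x (Arr.id V f.src) h = x := M.ract_id' _ _ _
  have a2 : M.lact x (Arr.id V f.src) h = Arr.id V (M.lact x f h).src := by
    rw [M.lact_id, M.src_lact]
  have a3 : M.lact (fst B (Arr.id V f.src) f rfl) f (tgt_fst B _ _ _) = f :=
    (M.lact_congr (fst_id B _ _ _) rfl _ rfl).trans (M.id_lact f)
  have h1 : (M.ract x (Arr.id V f.src) h).tgt = f.src := M.tgt_ract _ _ _
  have h2 : (M.lact x (Arr.id V f.src) h).tgt = (M.lact _ f h1).src :=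
    (M.tgt_lact _ _ _).trans (M.src_lact _ _ _).symm
  have h3 := snd_comp B x (Arr.id V f.src) f rfl h h1 h2 (h.trans (congrArg Arr.src a3).symm)
  refine Eq.trans ?_ (h3.trans (Arr.comp_congr (M.ract_congr rfl a3 _ _) rfl _ _))
  exact Arr.comp_congr (snd_congr B a2.symm (M.lact_congr a1.symm rfl _ _) _ _) rfl _ _

/-- The rotation `η` of a braiding: `η(g)` is the arrow by which elements of degree `g` act on the
elements they are moved past. -/
def eta : Rotation M where
  toFun g := fst B g (Arr.id V g.tgt) rfl
  src_map g := src_fst B _ _ _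
  tgt_map g := tgt_fst B _ _ _
  map_id a := fst_id B _ _ _
  map_comp f g h := by
    have h1 : f.tgt = (M.lact (fst B g (Arr.id V g.tgt) rfl) (Arr.id V g.tgt)
        (tgt_fst B _ _ _)).src :=
      h.trans ((src_fst B _ _ _).symm.trans (M.src_lact _ _ _).symm)
    refine (fst_comp_left B f g (Arr.id V g.tgt) h rfl h1 ?_).trans
      (Arr.comp_congr (fst_eq B _ _ _) rfl _ _)
    exact (tgt_fst B _ _ _).trans (M.src_lact _ _ _)
  comp_map y g h := by
    have h1 : (M.ract y g h).tgt = g.tgt := M.tgt_ract _ _ _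
    refine (fst_comp B y g (Arr.id V g.tgt) rfl h h1
      ((M.tgt_lact _ _ _).trans (M.src_lact _ _ _).symm)).symm.trans ?_
    exact Arr.comp_congr (fst_eq B _ _ _) rfl _ _

/-- The rotation `ξ` of a braiding: `ξ(f)⁻¹` is the arrow by which elements of degree `f` act on
elements of identity degree that are moved past them. -/
def xi : Rotation M where
  toFun f := (snd B (Arr.id V f.src) f rfl).inv
  src_map f := tgt_snd B _ _ _
  tgt_map f := src_snd_id B f
  map_id a := by rw [snd_id_id, Arr.inv_id]
  map_comp f g h := by rw [snd_id_comp B f g h, Arr.comp_inv_rev]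
  comp_map y g h := by
    exact (Arr.inv_comp_eq_comp_inv _ _ (snd_id_comp_ract B y g h).symm _ _).symm

theorem snd_eq_ract_xi (g f : Arr V) (h : g.tgt = f.src) :
    snd B g f h = M.ract ((xi B).toFun f).inv g.inv (((xi B).src_map f).trans h.symm) :=
  (snd_eq B g f h).trans (M.ract_congr (Arr.inv_inv _).symm rfl _ _)

theorem lact_snd (g f : Arr V) (h : g.tgt = f.src) :
    M.lact (snd B g f h) g (tgt_snd B g f h) =
      (M.lact ((xi B).toFun f).inv g.inv (((xi B).src_map f).trans h.symm)).inv :=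
  (M.lact_congr (snd_eq_ract_xi B g f h) (Arr.inv_inv g).symm _ (M.tgt_ract _ _ _)).trans
    (M.lact_inv _ _ _)

theorem lact_fst (g f : Arr V) (h : g.tgt = f.src) :
    M.lact ((eta B).toFun g) f (((eta B).tgt_map g).trans h) =
      M.lact (fst B g f h) f (tgt_fst B g f h) :=
  M.lact_congr (fst_eq B g f h).symm rfl _ _

/-- The matched pair of rotations of a braiding. -/
def toRotationPair : RotationPair M where
  ξ := xi B
  η := eta B
  tgt_eq g f h := by
    have h1 := congrArg Arr.src (lact_snd B g f h)
    exact (congrArg Arr.tgt (lact_fst B g f h)).trans ((lact_fst_tgt B g f h).trans h1)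
  comp_eq g f h :=
    (Arr.comp_congr (lact_fst B g f h) (lact_snd B g f h).symm _ (lact_fst_tgt B g f h)).trans
      (lact_fst_comp B g f h)

/-- Braidings with the same underlying morphisms are equal. -/
theorem ext_hom {B B' : BraidedCategory (Representation M)}
    (h : ∀ E D, (B.braiding E D).hom = (B'.braiding E D).hom) : B = B' := by
  have h1 : B.braiding = B'.braiding := funext fun E => funext fun D => Iso.ext (h E D)
  cases B
  cases B'
  cases h1
  rfl

theorem toBraided_toRotationPair : (toRotationPair B).toBraided = B := by
  have h1 : ∀ E D : Representation M,
      ((toRotationPair B).toBraided.braiding E D).hom = (B.braiding E D).hom := by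
    intro E D
    apply Representation.hom_ext
    intro z
    refine Subtype.ext (Prod.ext ?_ ?_)
    · exact (D.act_congr (fst_eq B _ _ _).symm rfl _).trans (app_fst B E D z).symm
    · exact (E.act_congr (snd_eq_ract_xi B _ _ _).symm rfl _).trans (app_snd B E D z).symm
  exact ext_hom h1

theorem fst_toBraided (ρ : RotationPair M) (g f : Arr V) (h : g.tgt = f.src) :
    fst ρ.toBraided g f h = ρ.η.toFun g :=
  (free_act_gen (M := M) f _ (ρ.tgt_eta _ _ (genPair M g f h).2)).trans (congrArg _ (deg_gen g))

theorem snd_toBraided (ρ : RotationPair M) (g f : Arr V) (h : g.tgt = f.src) :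
    snd ρ.toBraided g f h = ρ.coaction g f h :=
  (free_act_gen (M := M) g _ (ρ.tgt_coaction _ _ (genPair M g f h).2)).trans
    (ρ.coaction_congr (deg_gen g) (deg_gen f) _ _)

theorem toRotationPair_toBraided (ρ : RotationPair M) : toRotationPair ρ.toBraided = ρ := by
  refine RotationPair.ext (Rotation.ext (funext fun f => ?_)) (Rotation.ext (funext fun g => ?_))
  · show (snd ρ.toBraided (Arr.id V f.src) f rfl).inv = _
    rw [snd_toBraided]
    refine (congrArg Arr.inv ?_).trans (Arr.inv_inv _)
    exact (M.ract_congr rfl (Arr.inv_id _) _ (ρ.ξ.src_map f)).trans (M.ract_id' _ _ _)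
  · exact fst_toBraided ρ g _ rfl

end Braiding
end MatchedPair

theorem theorem4 {P : Type u} {V H : Groupoid.{u} P} (M : MatchedPair V H) :
    ∃ Φ : MatchedPair.RotationPair M ≃ BraidedCategory (MatchedPair.Representation M),
      ∀ (ρ : MatchedPair.RotationPair M) (E D : MatchedPair.Representation M)
        (e : E.carrier) (d : D.carrier) (h : E.q e = D.p d),
        (MatchedPair.Representation.Hom.toFun ((Φ ρ).braiding E D).hom ⟨(e, d), h⟩).1 =
          (D.act (ρ.η.toFun (E.deg e)) d ((ρ.η.tgt_map (E.deg e)).trans h),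
            E.act
              (M.ract (ρ.ξ.toFun (D.deg d)).inv (E.deg e).inv
                ((ρ.ξ.src_map (D.deg d)).trans h.symm))
              e (M.tgt_ract _ _ _)) :=
  ⟨{ toFun := fun ρ => ρ.toBraided
     invFun := MatchedPair.Braiding.toRotationPair
     left_inv := MatchedPair.Braiding.toRotationPair_toBraided
     right_inv := MatchedPair.Braiding.toBraided_toRotationPair }, fun _ _ _ _ _ _ => rfl⟩
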